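/- **Theorem 5.5.** Let $q$ be a prime power and let $\alpha$ be a collineation of order $3$ of $\mathrm{PG}(2,q^3)$ whose fixed points constitute a subplane isomorphic to $\mathrm{PG}(2,q)$. Let $\mathcal O_1$ be the set of points fixed by $\alpha$; let $\mathcal O_3$ be the set of points $x$ such that $x, x^{\alpha}, x^{\alpha^2}$ are distinct and not on a common line, and let $\mathcal L_3$ be the set of lines $\ell$ such that $\ell,\ell^{\alpha},\ell^{\alpha^2}$ are distinct and not through a common point. Let $\mu$ be the involutory bijection between $\mathcal O_3$ and $\mathcal L_3$ given by $x^{\mu}=x^{\alpha}x^{\alpha^2}$ (the line joining these points) for $x\in\mathcal O_3$ and $\ell^{\mu}=\ell^{\alpha}\cap\ell^{\alpha^2}$ for $\ell\in\mathcal L_3$. The Figueroa plane $\mathcal F$ has the points of $\mathrm{PG}(2,q^3)$ as its points and one line $\ell_{\mathcal F}$ for each line $\ell$ of $\mathrm{PG}(2,q^3)$; if $x\in\mathcal O_3$ and $\ell\in\mathcal L_3$, then $x\in\ell_{\mathcal F}$ if and only if $\ell^{\mu}\in x^{\mu}$, and in all other cases $x\in\ell_{\mathcal F}$ if and only if $x\in\ell$.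 Let $\rho$ be a polarity of $\mathrm{PG}(2,q^3)$ (an incidence-preserving involutory bijection interchanging points and lines) with $\rho\alpha=\alpha\rho$, and let $\rho_{\mathcal F}$ be the induced polarity of $\mathcal F$, given by $x^{\rho_{\mathcal F}}=(x^{\rho})_{\mathcal F}$ for points $x$ and $(\ell_{\mathcal F})^{\rho_{\mathcal F}}=\ell^{\rho}$ for lines $\ell$. With respect to a polarity $\sigma$, a point $x$ is called absolute if $x\in x^{\sigma}$, and a set of points is called triangle-free if it does not contain three distinct points each two of which, $x$ and $y$, satisfy $x\in y^{\sigma}$. Let $\mathcal Z$ be a triangle-free set, with respect to $\rho$, of points that are not absolute with respect to $\rho$. Then $$\mathcal Z_{\mathcal F}=(\mathcal Z\cap\mathcal O_1)\cup\{x^{\mu\rho} : x\in\mathcal Z\cap\mathcal O_3\}$$ consists of points that are not absolute with respect to $\rho_{\mathcal F}$ and is triangle-free with respect to $\rho_{\mathcal F}$. -/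

import Mathlib

open Configuration
open scoped LinearAlgebra.Projectivization

/-- The points of `PG(2, K)`: the one-dimensional subspaces of `K³`. -/
abbrev PGPoint (K : Type*) [Field K] := ℙ K (Fin 3 → K)

/-- The lines of `PG(2, K)` in homogeneous line coordinates: the point `⟨x⟩` lies on the line
with coordinates `⟨a⟩` exactly if `a₀ x₀ + a₁ x₁ + a₂ x₂ = 0`. This incidence, and the fact that
it is a projective plane, are in Mathlib. -/
abbrev PGLine (K : Type*) [Field K] := ℙ K (Fin 3 → K)

/-- A polarity of an incidence structure with points `P` and lines `L`: a bijection from points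
to lines which, together with its inverse from lines to points (so that the whole map on
`P ∪ L` is an involution), preserves incidence. -/
structure Polarity (P L : Type*) [Membership P L] where
  /-- The map from points to lines; its inverse is the map from lines to points. -/
  toEquiv : P ≃ L
  mem_iff : ∀ (x : P) (l : L), toEquiv.symm l ∈ toEquiv x ↔ x ∈ l

namespace Polarity

variable {P L : Type*} [Membership P L]

/-- The polar line of a point. -/
def onPoint (ρ : Polarity P L) (x : P) : L := ρ.toEquiv x

/-- The pole of a line. -/
def onLine (ρ : Polarity P L) (l : L) : P := ρ.toEquiv.symm l

@[simp] theorem onLine_onPoint (ρ : Polarity P L) (x : P) : ρ.onLine (ρ.onPoint x) = x :=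
  ρ.toEquiv.symm_apply_apply x

@[simp] theorem onPoint_onLine (ρ : Polarity P L) (l : L) : ρ.onPoint (ρ.onLine l) = l :=
  ρ.toEquiv.apply_symm_apply l

theorem onLine_mem_onPoint (ρ : Polarity P L) (x : P) (l : L) :
    ρ.onLine l ∈ ρ.onPoint x ↔ x ∈ l := ρ.mem_iff x l

/-- A point is absolute if it lies on its polar line. -/
def IsAbsolute (ρ : Polarity P L) (x : P) : Prop := x ∈ ρ.onPoint x

/-- The polarity graph (without its loops, which sit exactly at the absolute points): two
distinct points are adjacent if one lies on the polar line of the other. -/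
def graph (ρ : Polarity P L) : SimpleGraph P where
  Adj x y := x ≠ y ∧ x ∈ ρ.onPoint y
  symm := ⟨fun x y h => ⟨h.1.symm, by
    have := (ρ.onLine_mem_onPoint x (ρ.onPoint y)).2 h.2
    rwa [onLine_onPoint] at this⟩⟩
  loopless := ⟨fun _ h => h.1 rfl⟩

/-- A set of points is triangle-free if it contains no three distinct pairwise adjacent points
of the polarity graph. -/
def TriangleFree (ρ : Polarity P L) (Z : Set P) : Prop := ρ.graph.CliqueFreeOn Z 3

end Polarity

/-- A collineation of order three. -/
structure OrderThreeCollineation (P L : Type*) [Membership P L] where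
  /-- The action on points. -/
  onPoint : P ≃ P
  /-- The action on lines. -/
  onLine : L ≃ L
  mem_iff : ∀ (x : P) (l : L), onPoint x ∈ onLine l ↔ x ∈ l
  orderOf_onPoint : orderOf onPoint = 3

namespace OrderThreeCollineation

section Types

variable {P L : Type*} [Membership P L] (α : OrderThreeCollineation P L)

/-- Points of type 1: the fixed points. -/
def O1 : Set P := {x | α.onPoint x = x}

/-- Points of type 3: `x`, `x^α`, `x^(α²)` are distinct and not on a common line. -/
def O3 : Set P := {x | x ≠ α.onPoint x ∧ α.onPoint x ≠ α.onPoint (α.onPoint x) ∧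
  x ≠ α.onPoint (α.onPoint x) ∧
  ¬ ∃ l : L, x ∈ l ∧ α.onPoint x ∈ l ∧ α.onPoint (α.onPoint x) ∈ l}

/-- Lines of type 3: `l`, `l^α`, `l^(α²)` are distinct and not through a common point. -/
def L3 : Set L := {l | l ≠ α.onLine l ∧ α.onLine l ≠ α.onLine (α.onLine l) ∧
  l ≠ α.onLine (α.onLine l) ∧
  ¬ ∃ x : P, x ∈ l ∧ x ∈ α.onLine l ∧ x ∈ α.onLine (α.onLine l)}

/-- The fixed points of `α` constitute a subplane isomorphic to `PG(2, k)`: there is a bijection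
of the points of `PG(2, k)` with the fixed points, under which the lines of `PG(2, k)` correspond
to the intersections of lines with the set of fixed points. -/
def FixesSubplane (k : Type*) [Field k] : Prop :=
  ∃ (e : PGPoint k ≃ α.O1) (g : PGLine k → L),
    ∀ (x : PGPoint k) (l : PGLine k), x ∈ l ↔ (e x : P) ∈ g l

/-- The collineation commutes with the polarity, on points and on lines. -/
def Commutes (ρ : Polarity P L) : Prop :=
  (∀ x : P, ρ.onPoint (α.onPoint x) = α.onLine (ρ.onPoint x)) ∧
    ∀ l : L, ρ.onLine (α.onLine l) = α.onPoint (ρ.onLine l)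

theorem onPoint_three (x : P) : α.onPoint (α.onPoint (α.onPoint x)) = x := by
  have h := pow_orderOf_eq_one α.onPoint
  rw [α.orderOf_onPoint] at h
  exact congrArg (fun f : Equiv.Perm P => f x) h

end Types

set_option linter.unusedSectionVars false

section Plane

variable {P L : Type*} [Membership P L] [ProjectivePlane P L] (α : OrderThreeCollineation P L)

theorem onLine_three (l : L) : α.onLine (α.onLine (α.onLine l)) = l := by
  have key : ∀ x : P, x ∈ l → x ∈ α.onLine (α.onLine (α.onLine l)) := by
    intro x hx
    have := (α.mem_iff _ _).2 ((α.mem_iff _ _).2 ((α.mem_iff _ _).2 hx))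
    rwa [α.onPoint_three] at this
  by_contra hne
  -- all points of `l` would coincide
  have huniq : ∀ x y : P, x ∈ l → y ∈ l → x = y := fun x y hx hy =>
    (Nondegenerate.eq_or_eq (key x hx) (key y hy) hx hy).resolve_right hne
  have meet : ∀ m : L, ∃ x : P, x ∈ l ∧ x ∈ m := by
    intro m
    by_cases hm : l = m
    · subst hm
      have hne' : l ≠ α.onLine (α.onLine (α.onLine l)) := fun h => hne h.symm
      exact ⟨HasPoints.mkPoint hne', (HasPoints.mkPoint_ax hne').1, (HasPoints.mkPoint_ax hne').1⟩
    · exact ⟨HasPoints.mkPoint hm, HasPoints.mkPoint_ax hm⟩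
  -- the point of `l` would lie on every line
  obtain ⟨x, hx, -⟩ := meet l
  obtain ⟨n, hn⟩ := Nondegenerate.exists_line (L := L) x
  obtain ⟨y, hy, hyn⟩ := meet n
  exact hn (huniq x y hx hy ▸ hyn)

variable {α}

theorem line_unique {x y : P} (hxy : x ≠ y) {l m : L} (hxl : x ∈ l) (hyl : y ∈ l)
    (hxm : x ∈ m) (hym : y ∈ m) : l = m :=
  (Nondegenerate.eq_or_eq hxl hyl hxm hym).resolve_left hxy

theorem point_unique {x y : P} {l m : L} (hlm : l ≠ m) (hxl : x ∈ l) (hxm : x ∈ m)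
    (hyl : y ∈ l) (hym : y ∈ m) : x = y :=
  (Nondegenerate.eq_or_eq hxl hyl hxm hym).resolve_right hlm

theorem mem_L3_of_mem_O3 {x : P} (hx : x ∈ α.O3) {l : L} (h1 : α.onPoint x ∈ l)
    (h2 : α.onPoint (α.onPoint x) ∈ l) : l ∈ α.L3 := by
  obtain ⟨d1, d2, d3, hl⟩ := hx
  have a1 : α.onPoint (α.onPoint x) ∈ α.onLine l := (α.mem_iff _ _).2 h1
  have a2 : x ∈ α.onLine l := by
    have := (α.mem_iff _ _).2 h2
    rwa [α.onPoint_three] at this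
  have b1 : x ∈ α.onLine (α.onLine l) := by
    have := (α.mem_iff _ _).2 a1
    rwa [α.onPoint_three] at this
  have b2 : α.onPoint x ∈ α.onLine (α.onLine l) := (α.mem_iff _ _).2 a2
  have e1 : l ≠ α.onLine l := fun h => hl ⟨l, h ▸ a2, h1, h2⟩
  have e2 : α.onLine l ≠ α.onLine (α.onLine l) := fun h => hl ⟨_, b1, b2, h ▸ a1⟩
  have e3 : l ≠ α.onLine (α.onLine l) := fun h => hl ⟨l, h ▸ b1, h1, h2⟩
  refine ⟨e1, e2, e3, ?_⟩
  rintro ⟨p, p1, p2, p3⟩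
  exact d3 ((point_unique e2 a2 b1 p2 p3).trans (point_unique e1 p1 p2 h2 a1))

theorem mem_O3_of_mem_L3 {l : L} (hl : l ∈ α.L3) {x : P} (h1 : x ∈ α.onLine l)
    (h2 : x ∈ α.onLine (α.onLine l)) : x ∈ α.O3 := by
  obtain ⟨d1, d2, d3, hx⟩ := hl
  have a1 : α.onPoint x ∈ α.onLine (α.onLine l) := (α.mem_iff _ _).2 h1
  have a2 : α.onPoint x ∈ l := by
    have := (α.mem_iff _ _).2 h2
    rwa [α.onLine_three] at this
  have b1 : α.onPoint (α.onPoint x) ∈ l := by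
    have := (α.mem_iff _ _).2 a1
    rwa [α.onLine_three] at this
  have b2 : α.onPoint (α.onPoint x) ∈ α.onLine l := (α.mem_iff _ _).2 a2
  have e1 : x ≠ α.onPoint x := fun h => hx ⟨x, h ▸ a2, h1, h2⟩
  have e2 : α.onPoint x ≠ α.onPoint (α.onPoint x) := fun h => hx ⟨_, b1, b2, h ▸ a1⟩
  have e3 : x ≠ α.onPoint (α.onPoint x) := fun h => hx ⟨x, h ▸ b1, h1, h2⟩
  refine ⟨e1, e2, e3, ?_⟩
  rintro ⟨m, m1, m2, m3⟩
  exact d3 ((line_unique e2 a2 b1 m2 m3).trans (line_unique e1 m1 m2 h2 a1))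

variable (α)

/-- The involutory bijection between points and lines of type 3: `x^μ` is the line joining `x^α`
and `x^(α²)`, and `l^μ` (the inverse map) is the intersection of `l^α` and `l^(α²)`. -/
def mu : α.O3 ≃ α.L3 where
  toFun x := ⟨HasLines.mkLine (L := L) x.2.2.1,
    mem_L3_of_mem_O3 x.2 (HasLines.mkLine_ax x.2.2.1).1 (HasLines.mkLine_ax x.2.2.1).2⟩
  invFun l := ⟨HasPoints.mkPoint (P := P) l.2.2.1,
    mem_O3_of_mem_L3 l.2 (HasPoints.mkPoint_ax l.2.2.1).1 (HasPoints.mkPoint_ax l.2.2.1).2⟩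
  left_inv x := by
    apply Subtype.ext
    have hL := mem_L3_of_mem_O3 x.2 (HasLines.mkLine_ax (L := L) x.2.2.1).1
      (HasLines.mkLine_ax x.2.2.1).2
    have h1 := (α.mem_iff _ _).2 (HasLines.mkLine_ax (L := L) x.2.2.1).2
    have h2 := (α.mem_iff _ _).2 ((α.mem_iff _ _).2 (HasLines.mkLine_ax (L := L) x.2.2.1).1)
    rw [α.onPoint_three] at h1 h2
    exact point_unique hL.2.1 (HasPoints.mkPoint_ax hL.2.1).1 (HasPoints.mkPoint_ax hL.2.1).2 h1 h2
  right_inv l := by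
    apply Subtype.ext
    have hO := mem_O3_of_mem_L3 l.2 (HasPoints.mkPoint_ax (P := P) l.2.2.1).1
      (HasPoints.mkPoint_ax l.2.2.1).2
    have h1 := (α.mem_iff _ _).2 (HasPoints.mkPoint_ax (P := P) l.2.2.1).2
    have h2 := (α.mem_iff _ _).2 ((α.mem_iff _ _).2 (HasPoints.mkPoint_ax (P := P) l.2.2.1).1)
    rw [α.onLine_three] at h1 h2
    exact line_unique hO.2.1 (HasLines.mkLine_ax hO.2.1).1 (HasLines.mkLine_ax hO.2.1).2 h1 h2

theorem mu_spec (x : α.O3) : α.onPoint x ∈ (α.mu x : L) ∧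
    α.onPoint (α.onPoint x) ∈ (α.mu x : L) := HasLines.mkLine_ax (L := L) x.2.2.1

theorem mu_symm_spec (l : α.L3) : (α.mu.symm l : P) ∈ α.onLine (l : L) ∧
    (α.mu.symm l : P) ∈ α.onLine (α.onLine (l : L)) := HasPoints.mkPoint_ax (P := P) l.2.2.1

/-- Incidence of the Figueroa plane between the points `P` and the lines `L` of the original
plane, the line `l` being the label of the Figueroa line `l_F`: if `x` and `l` are both of type 3,
then `x` is on `l_F` exactly if `l^μ` lies on `x^μ`; in all other cases incidence is unchanged. -/
def FigueroaMem (x : P) (l : L) : Prop :=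
  (∃ (hx : x ∈ α.O3) (hl : l ∈ α.L3), (α.mu.symm ⟨l, hl⟩ : P) ∈ (α.mu ⟨x, hx⟩ : L)) ∨
    (¬ (x ∈ α.O3 ∧ l ∈ α.L3) ∧ x ∈ l)

/-- The type of lines of the Figueroa plane: a copy of `L`, where `l` stands for `l_F`. -/
@[nolint unusedArguments]
def FigueroaLine (_α : OrderThreeCollineation P L) : Type _ := L

/-- The line `l_F` of the Figueroa plane that corresponds to the line `l`. -/
def figueroaLine (l : L) : FigueroaLine α := l

/-- The Figueroa plane: the points `P`, the lines `FigueroaLine α`, and this incidence. -/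
instance : Membership P (FigueroaLine α) := ⟨fun l x => α.FigueroaMem x l⟩

theorem mem_figueroaLine (x : P) (l : L) : x ∈ α.figueroaLine l ↔ α.FigueroaMem x l := Iff.rfl

/-- The Figueroa line of a line `x^μ` of type 3, as a modified point set: the points of type 3 on
`x^μ` other than `x^α`, `x^(α²)` are replaced by the points `z^(α²)`, where `z` runs through the
points of type 3 such that the line `m` joining `z`, `z^α` passes through `x` and differs from the
lines `x x^α` and `x x^(α²)`. -/
theorem mem_figueroaLine_mu (x : α.O3) (p : P) :
    p ∈ α.figueroaLine (α.mu x : L) ↔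
      (p ∈ (α.mu x : L) ∧
        ¬ (p ∈ α.O3 ∧ p ≠ α.onPoint x ∧ p ≠ α.onPoint (α.onPoint x))) ∨
      ∃ z ∈ α.O3, ∃ m : L, z ∈ m ∧ α.onPoint z ∈ m ∧ (x : P) ∈ m ∧ α.onPoint x ∉ m ∧
        α.onPoint (α.onPoint x) ∉ m ∧ p = α.onPoint (α.onPoint z) := by
  have shift : ∀ y : P, y ∈ α.O3 → α.onPoint y ∈ α.O3 := by
    rintro y ⟨h1, h2, h3, h4⟩
    refine ⟨fun h => h1 (α.onPoint.injective h), fun h => h2 (α.onPoint.injective h),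
      fun h => h3 (α.onPoint.injective h), ?_⟩
    rintro ⟨l, l1, l2, l3⟩
    rw [α.onPoint_three] at l3
    exact h4 ⟨l, l3, l1, l2⟩
  have muEq : ∀ (y : α.O3) (m : L), α.onPoint y ∈ m → α.onPoint (α.onPoint y) ∈ m →
      (α.mu y : L) = m := fun y m h1 h2 =>
    line_unique y.2.2.1 (α.mu_spec y).1 (α.mu_spec y).2 h1 h2
  have hmem : p ∈ α.figueroaLine (α.mu x : L) ↔
      (∃ hp : p ∈ α.O3, (x : P) ∈ (α.mu ⟨p, hp⟩ : L)) ∨ (p ∉ α.O3 ∧ p ∈ (α.mu x : L)) := by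
    rw [mem_figueroaLine, FigueroaMem]
    have hx : (α.mu x : L) ∈ α.L3 := (α.mu x).2
    simp [hx]
  rw [hmem]
  constructor
  · rintro (⟨hp, h⟩ | ⟨hp, h⟩)
    · by_cases hp1 : p = α.onPoint x
      · left; subst hp1; exact ⟨(α.mu_spec x).1, fun h => h.2.1 rfl⟩
      by_cases hp2 : p = α.onPoint (α.onPoint x)
      · left; subst hp2; exact ⟨(α.mu_spec x).2, fun h => h.2.2 rfl⟩
      right
      have hs := α.mu_spec ⟨p, hp⟩
      refine ⟨α.onPoint p, shift p hp, _, hs.1, hs.2, h, fun h' => hp2 ?_, fun h' => hp1 ?_,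
        (α.onPoint_three p).symm⟩
      · have hx2 := shift _ (shift _ x.2)
        have := muEq ⟨_, hx2⟩ (α.mu ⟨p, hp⟩ : L) (by simpa [α.onPoint_three] using h)
          (by simpa [α.onPoint_three] using h')
        exact congrArg Subtype.val (α.mu.injective (Subtype.ext this)).symm
      · have hx1 := shift _ x.2
        have := muEq ⟨_, hx1⟩ (α.mu ⟨p, hp⟩ : L) h' (by simpa [α.onPoint_three] using h)
        exact congrArg Subtype.val (α.mu.injective (Subtype.ext this)).symm
    · exact Or.inl ⟨h, fun h' => hp h'.1⟩
  · rintro (⟨h, h'⟩ | ⟨z, hz, m, h1, h2, h3, -, -, rfl⟩)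
    · by_cases hp : p ∈ α.O3
      · left
        refine ⟨hp, ?_⟩
        by_cases hp1 : p = α.onPoint x
        · subst hp1
          simpa [α.onPoint_three] using (α.mu_spec ⟨_, hp⟩).2
        by_cases hp2 : p = α.onPoint (α.onPoint x)
        · subst hp2
          simpa [α.onPoint_three] using (α.mu_spec ⟨_, hp⟩).1
        exact absurd ⟨hp, hp1, hp2⟩ h'
      · exact Or.inr ⟨hp, h⟩
    · left
      have hz2 := shift _ (shift _ hz)
      refine ⟨hz2, ?_⟩
      rw [muEq ⟨_, hz2⟩ m (by simpa [α.onPoint_three] using h1)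
        (by simpa [α.onPoint_three] using h2)]
      exact h3

variable {α}

theorem Commutes.onPoint_mem_L3 {ρ : Polarity P L} (h : α.Commutes ρ) {x : P} (hx : x ∈ α.O3) :
    ρ.onPoint x ∈ α.L3 := by
  obtain ⟨d1, d2, d3, hl⟩ := hx
  have inj : Function.Injective ρ.onPoint := ρ.toEquiv.injective
  refine ⟨?_, ?_, ?_, ?_⟩
  · rw [← h.1]; exact inj.ne d1
  · rw [← h.1, ← h.1]; exact inj.ne d2
  · rw [← h.1, ← h.1]; exact inj.ne d3
  · rintro ⟨p, p1, p2, p3⟩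
    rw [← h.1] at p2 p3
    rw [← h.1] at p3
    refine hl ⟨ρ.onPoint p, ?_, ?_, ?_⟩
    · simpa using (ρ.onLine_mem_onPoint p (ρ.onPoint x)).2 p1
    · simpa using (ρ.onLine_mem_onPoint p _).2 p2
    · simpa using (ρ.onLine_mem_onPoint p _).2 p3

theorem Commutes.onLine_mem_O3 {ρ : Polarity P L} (h : α.Commutes ρ) {l : L} (hl : l ∈ α.L3) :
    ρ.onLine l ∈ α.O3 := by
  obtain ⟨d1, d2, d3, hx⟩ := hl
  have inj : Function.Injective ρ.onLine := ρ.toEquiv.symm.injective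
  refine ⟨?_, ?_, ?_, ?_⟩
  · rw [← h.2]; exact inj.ne d1
  · rw [← h.2, ← h.2]; exact inj.ne d2
  · rw [← h.2, ← h.2]; exact inj.ne d3
  · rintro ⟨m, m1, m2, m3⟩
    rw [← h.2] at m2 m3
    rw [← h.2] at m3
    have key : ∀ n : L, ρ.onLine n ∈ m → ρ.onLine m ∈ n := fun n hn => by
      simpa using (ρ.onLine_mem_onPoint (ρ.onLine n) m).2 hn
    exact hx ⟨ρ.onLine m, key _ m1, key _ m2, key _ m3⟩

theorem Commutes.onLine_mu {ρ : Polarity P L} (h : α.Commutes ρ) (x : α.O3) :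
    ρ.onLine (α.mu x : L) = (α.mu.symm ⟨ρ.onPoint x, h.onPoint_mem_L3 x.2⟩ : P) := by
  have hs := α.mu_symm_spec ⟨ρ.onPoint x, h.onPoint_mem_L3 x.2⟩
  refine point_unique (h.onPoint_mem_L3 x.2).2.1 ?_ ?_ hs.1 hs.2
  · rw [← h.1]; exact (ρ.onLine_mem_onPoint _ _).2 (α.mu_spec x).1
  · rw [← h.1, ← h.1]; exact (ρ.onLine_mem_onPoint _ _).2 (α.mu_spec x).2

theorem Commutes.onPoint_mu_symm {ρ : Polarity P L} (h : α.Commutes ρ) (l : α.L3) :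
    ρ.onPoint (α.mu.symm l : P) = (α.mu ⟨ρ.onLine l, h.onLine_mem_O3 l.2⟩ : L) := by
  have hs := α.mu_spec ⟨ρ.onLine l, h.onLine_mem_O3 l.2⟩
  refine line_unique (h.onLine_mem_O3 l.2).2.1 ?_ ?_ hs.1 hs.2
  · rw [← h.2]; exact (ρ.onLine_mem_onPoint _ _).2 (α.mu_symm_spec l).1
  · rw [← h.2, ← h.2]; exact (ρ.onLine_mem_onPoint _ _).2 (α.mu_symm_spec l).2

theorem Commutes.figueroaMem_iff {ρ : Polarity P L} (h : α.Commutes ρ) (x : P) (l : L) :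
    α.FigueroaMem (ρ.onLine l) (ρ.onPoint x) ↔ α.FigueroaMem x l := by
  have hx : ρ.onPoint x ∈ α.L3 ↔ x ∈ α.O3 :=
    ⟨fun h' => by simpa using h.onLine_mem_O3 h', h.onPoint_mem_L3⟩
  have hl : ρ.onLine l ∈ α.O3 ↔ l ∈ α.L3 :=
    ⟨fun h' => by simpa using h.onPoint_mem_L3 h', h.onLine_mem_O3⟩
  unfold FigueroaMem
  refine or_congr ?_ (and_congr (not_congr ?_) (ρ.onLine_mem_onPoint x l))
  · constructor
    · rintro ⟨h1, h2, h3⟩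
      refine ⟨hx.1 h2, hl.1 h1, ?_⟩
      rw [← h.onLine_mu ⟨x, hx.1 h2⟩, ← h.onPoint_mu_symm ⟨l, hl.1 h1⟩] at h3
      exact (ρ.onLine_mem_onPoint _ _).1 h3
    · rintro ⟨h1, h2, h3⟩
      refine ⟨hl.2 h2, hx.2 h1, ?_⟩
      rw [← h.onLine_mu ⟨x, h1⟩, ← h.onPoint_mu_symm ⟨l, h2⟩]
      exact (ρ.onLine_mem_onPoint _ _).2 h3
  · rw [hx, hl, and_comm]

/-- The polarity `ρ_F` of the Figueroa plane inherited from a polarity `ρ` that commutes with `α`: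
it maps the point `x` to `(x^ρ)_F` and the line `l_F` to the point `l^ρ`. -/
def figueroaPolarity (ρ : Polarity P L) (h : α.Commutes ρ) : Polarity P (FigueroaLine α) where
  toEquiv := ρ.toEquiv
  mem_iff x l := h.figueroaMem_iff x l

variable (α)

/-- The set `Z_F = (Z ∩ O₁) ∪ {x^(μρ) | x ∈ Z ∩ O₃}`. -/
def figueroaSet (ρ : Polarity P L) (Z : Set P) : Set P :=
  (Z ∩ α.O1) ∪ {y | ∃ x : α.O3, (x : P) ∈ Z ∧ y = ρ.onLine (α.mu x : L)}

end Plane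

end OrderThreeCollineation

/-! Edges of the polarity graph of `ρ_F` inside `Z_F` come from edges of the graph of `ρ` inside
`Z`. Since `ρ` commutes with `α`, it commutes with `μ`. Put `x' = x^(μρ)` for `x` of type 3; then
`x'^μ = x^ρ`, while the polar of `y'` is `(y^μ)_F`. By the Figueroa rule, `x'` lies on that line iff
`(y^μ)^μ = y` lies on `x'^μ = x^ρ`. So `x ↦ x'` turns polarity with respect to `ρ_F` into polarity
with respect to `ρ` (`mem_onPoint_figueroaPolarity_onLine_mu`); the case `x = y` handles absolute
points. At fixed points incidence is unchanged, and a fixed point lies on no line of type 3, so no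
edge of `ρ_F` joins a fixed point to some `x'` (`not_adj_figueroaPolarity_onLine_mu`). A triangle in
`Z_F` is therefore of one kind only and gives a triangle in `Z`. -/

namespace Polarity

variable {P L : Type*} [Membership P L]

theorem triangleFree_iff {ρ : Polarity P L} {Z : Set P} :
    ρ.TriangleFree Z ↔ ∀ a ∈ Z, ∀ b ∈ Z, ∀ c ∈ Z,
      ρ.graph.Adj a b → ρ.graph.Adj a c → ¬ ρ.graph.Adj b c := by
  classical
  constructor
  · intro h a ha b hb c hc hab hac hbc
    refine h (t := {a, b, c}) ?_ (SimpleGraph.is3Clique_iff.2 ⟨a, b, c, hab, hac, hbc, rfl⟩)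
    intro x hx
    simp only [Finset.coe_insert, Finset.coe_singleton, Set.mem_insert_iff,
      Set.mem_singleton_iff] at hx
    rcases hx with rfl | rfl | rfl <;> assumption
  · intro h t ht hcl
    obtain ⟨a, b, c, hab, hac, hbc, rfl⟩ := SimpleGraph.is3Clique_iff.1 hcl
    exact h a (ht (by simp)) b (ht (by simp)) c (ht (by simp)) hab hac hbc

end Polarity

/-! ### Polarity in the Figueroa plane at fixed points and at points `x^(μρ)` -/

namespace OrderThreeCollineation

variable {P L : Type*} [Membership P L]

theorem not_mem_O3_of_mem_O1 {α : OrderThreeCollineation P L} {z : P} (hz : z ∈ α.O1) :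
    z ∉ α.O3 := fun h => h.1 hz.symm

/-- A fixed point lies on no line of type 3. -/
theorem not_mem_of_mem_O1_of_mem_L3 {α : OrderThreeCollineation P L} {z : P} (hz : z ∈ α.O1)
    {l : L} (hl : l ∈ α.L3) : z ∉ l := by
  intro h
  have hz' : α.onPoint z = z := hz
  have h1 : z ∈ α.onLine l := by simpa [hz'] using (α.mem_iff z l).2 h
  have h2 : z ∈ α.onLine (α.onLine l) := by simpa [hz'] using (α.mem_iff z _).2 h1
  exact hl.2.2.2 ⟨z, h, h1, h2⟩

variable [ProjectivePlane P L] {α : OrderThreeCollineation P L} {ρ : Polarity P L}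

theorem figueroaMem_iff_of_mem_O1 {z : P} (hz : z ∈ α.O1) (l : L) :
    α.FigueroaMem z l ↔ z ∈ l := by
  simp [FigueroaMem, not_mem_O3_of_mem_O1 hz]

/-- Point and line are both of type 3, so the modified rule applies: applying `μ` to both turns the
line `y^μ` into `y` and the point `x^(μρ)` into `x^ρ`. -/
theorem Commutes.figueroaMem_onLine_mu_iff (h : α.Commutes ρ) (x y : α.O3) :
    α.FigueroaMem (ρ.onLine (α.mu x : L)) (α.mu y : L) ↔ (y : P) ∈ ρ.onPoint x := by
  have hx : ρ.onLine (α.mu x : L) ∈ α.O3 := h.onLine_mem_O3 (α.mu x).2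
  -- `x^(μρμ) = x^(μμρ) = x^ρ`, because `ρ` and `μ` commute and `μ` is an involution.
  have key : (α.mu ⟨ρ.onLine (α.mu x : L), hx⟩ : L) = ρ.onPoint x := by
    rw [← h.onPoint_mu_symm (α.mu x), Equiv.symm_apply_apply]
  have hy : α.mu.symm ⟨(α.mu y : L), (α.mu y).2⟩ = y := α.mu.symm_apply_apply y
  constructor
  · rintro (⟨_, _, h3⟩ | ⟨hn, -⟩)
    · rwa [key, hy] at h3
    · exact absurd ⟨hx, (α.mu y).2⟩ hn
  · intro hm
    refine Or.inl ⟨hx, (α.mu y).2, ?_⟩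
    rwa [key, hy]

theorem adj_figueroaPolarity_of_mem_O1 (h : α.Commutes ρ) {z w : P} (hz : z ∈ α.O1) :
    (figueroaPolarity ρ h).graph.Adj z w ↔ ρ.graph.Adj z w :=
  and_congr_right fun _ => figueroaMem_iff_of_mem_O1 hz (ρ.onPoint w)

/-- With respect to `ρ`, the polar of `x^(μρ)` is `x^μ`, a line of type 3, which contains no fixed
point. -/
theorem not_adj_figueroaPolarity_onLine_mu (h : α.Commutes ρ) {z : P} (hz : z ∈ α.O1)
    (x : α.O3) : ¬ (figueroaPolarity ρ h).graph.Adj z (ρ.onLine (α.mu x : L)) := by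
  rw [adj_figueroaPolarity_of_mem_O1 h hz]
  rintro ⟨-, hm⟩
  rw [ρ.onPoint_onLine] at hm
  exact not_mem_of_mem_O1_of_mem_L3 hz (α.mu x).2 hm

theorem mem_onPoint_figueroaPolarity_onLine_mu (h : α.Commutes ρ) (x y : α.O3) :
    ρ.onLine (α.mu x : L) ∈ (figueroaPolarity ρ h).onPoint (ρ.onLine (α.mu y : L)) ↔
      (y : P) ∈ ρ.onPoint x := by
  rw [← h.figueroaMem_onLine_mu_iff x y]
  -- The polar of a point under `ρ_F` is, by definition, the Figueroa line labelled by its polar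
  -- under `ρ`; here that label is `y^μ`.
  change α.FigueroaMem _ (ρ.onPoint (ρ.onLine (α.mu y : L))) ↔ _
  rw [ρ.onPoint_onLine]

/-- The map `x ↦ x^(μρ)` carries edges of the polarity graph of `ρ_F` back to edges of that
of `ρ`. -/
theorem adj_of_adj_figueroaPolarity_onLine_mu (h : α.Commutes ρ) {x y : α.O3}
    (hxy : (figueroaPolarity ρ h).graph.Adj (ρ.onLine (α.mu x : L)) (ρ.onLine (α.mu y : L))) :
    ρ.graph.Adj (x : P) y := by
  -- The transfer exchanges the roles of `x` and `y`, so the edge is obtained from `y` to `x` first.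
  -- Distinct images force `x ≠ y`.
  refine SimpleGraph.Adj.symm ⟨fun e => hxy.1 ?_,
    (mem_onPoint_figueroaPolarity_onLine_mu h x y).1 hxy.2⟩
  rw [Subtype.ext e]

/-! ### The two properties of `Z_F` -/

theorem not_isAbsolute_figueroaPolarity (h : α.Commutes ρ) {Z : Set P}
    (hZ : ∀ x ∈ Z, ¬ ρ.IsAbsolute x) {y : P} (hy : y ∈ α.figueroaSet ρ Z) :
    ¬ (figueroaPolarity ρ h).IsAbsolute y := by
  rcases hy with ⟨hyZ, hy1⟩ | ⟨x, hxZ, rfl⟩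
  · exact fun ha => hZ y hyZ ((figueroaMem_iff_of_mem_O1 hy1 (ρ.onPoint y)).1 ha)
  -- The diagonal case of the transfer: `x^(μρ)` is absolute for `ρ_F` only if `x` is absolute for
  -- `ρ`.
  · exact fun ha => hZ x hxZ ((mem_onPoint_figueroaPolarity_onLine_mu h x x).1 ha)

theorem triangleFree_figueroaSet (h : α.Commutes ρ) {Z : Set P} (hZ : ρ.TriangleFree Z) :
    (figueroaPolarity ρ h).TriangleFree (α.figueroaSet ρ Z) := by
  rw [Polarity.triangleFree_iff] at hZ ⊢
  -- Each vertex is a fixed point or some `x^(μρ)`. In the six mixed cases `a` differs in kind from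
  -- `b` or `c`, so one of the edges at `a` is impossible; the first and last cases pull the whole
  -- triangle back to `Z`.
  rintro a (⟨haZ, ha⟩ | ⟨x, hx, rfl⟩) b (⟨hbZ, hb⟩ | ⟨y, hy, rfl⟩) c
    (⟨hcZ, hc⟩ | ⟨z, hz, rfl⟩) hab hac hbc
  · exact hZ a haZ b hbZ c hcZ ((adj_figueroaPolarity_of_mem_O1 h ha).1 hab)
      ((adj_figueroaPolarity_of_mem_O1 h ha).1 hac) ((adj_figueroaPolarity_of_mem_O1 h hb).1 hbc)
  · exact not_adj_figueroaPolarity_onLine_mu h ha z hac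
  · exact not_adj_figueroaPolarity_onLine_mu h ha y hab
  · exact not_adj_figueroaPolarity_onLine_mu h ha y hab
  · exact not_adj_figueroaPolarity_onLine_mu h hb x hab.symm
  · exact not_adj_figueroaPolarity_onLine_mu h hb x hab.symm
  · exact not_adj_figueroaPolarity_onLine_mu h hc x hac.symm
  · exact hZ x hx y hy z hz (adj_of_adj_figueroaPolarity_onLine_mu h hab)
      (adj_of_adj_figueroaPolarity_onLine_mu h hac) (adj_of_adj_figueroaPolarity_onLine_mu h hbc)

end OrderThreeCollineation

theorem theorem5p5 (q : ℕ)
    {k : Type*} [Field k] [Finite k] (hk : Nat.card k = q)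
    {K : Type*} [Field K] [Finite K] [DecidableEq K] (hK : Nat.card K = q ^ 3)
    (α : OrderThreeCollineation (PGPoint K) (PGLine K)) (hα : α.FixesSubplane k)
    (ρ : Polarity (PGPoint K) (PGLine K)) (hρ : α.Commutes ρ)
    (Z : Set (PGPoint K)) (hZ : ∀ x ∈ Z, ¬ ρ.IsAbsolute x) (hZfree : ρ.TriangleFree Z) :
    (∀ y ∈ α.figueroaSet ρ Z,
        ¬ (OrderThreeCollineation.figueroaPolarity ρ hρ).IsAbsolute y) ∧
      (OrderThreeCollineation.figueroaPolarity ρ hρ).TriangleFree (α.figueroaSet ρ Z) :=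
  ⟨fun _ hy => OrderThreeCollineation.not_isAbsolute_figueroaPolarity hρ hZ hy,
    OrderThreeCollineation.triangleFree_figueroaSet hρ hZfree⟩
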